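/- Let $n\ge 0$, let the symmetric group $S_n$ act on $X=\mathbb{C}^n$ by permuting coordinates, and let $\pi:\mathbb{C}^n\to Y=\mathbb{C}^n$, $\pi(x)=(e_1(x),\dots,e_n(x))$, be the quotient map given by the elementary symmetric polynomials; write $Y(\mathbb{R})=\mathbb{R}^n\subset Y$ for the real points. Let $h$ be any $S_n$-invariant Hermitian inner product on $\mathbb{C}^n$, with associated norm $\|\cdot\|_h$, and let $\mathcal{H}^n$ be the $n$-dimensional Hausdorff measure on $\mathbb{C}^n$ for the distance $\|x-x'\|_h$. For measurable $U\subset Y(\mathbb{R})$ put \[ \operatorname{vol}_{Y(\mathbb{R})}(U)=\frac{1}{n!}\,\mathcal{H}^n\big(\pi^{-1}(U)\big), \] and for $r>0$ let $B_{Y(\mathbb{R})}(r)\subset Y(\mathbb{R})$ be the ball of radius $r$ around $\pi(0)$ for the quotient distance $d(y,y')=\inf\{\|x-x'\|_h : \pi(x)=y,\ \pi(x')=y'\}$. Let $\mathrm{Inv}(S_n)=\{\sigma\in S_n : \sigma^2=\mathrm{id}\}$. Then for every $n$, every such $h$ and every $r>0$, \[ \frac{\operatorname{vol}_{Y(\mathbb{R})}\big(\pi(\mathbb{R}^n)\cap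 B_{Y(\mathbb{R})}(r)\big)}{\operatorname{vol}_{Y(\mathbb{R})}\big(B_{Y(\mathbb{R})}(r)\big)}=\frac{1}{\#\mathrm{Inv}(S_n)},\qquad \#\mathrm{Inv}(S_n)=\sum_{k=0}^{\lfloor n/2\rfloor}\frac{n!}{2^k\,k!\,(n-2k)!}. \] Moreover, as $n\to\infty$, $\#\mathrm{Inv}(S_n)=O(n^{n/2})$, and there exists a constant $C>0$ such that \[ \frac{1}{\#\mathrm{Inv}(S_n)}=O\big(e^{-Cn\log n}\big). \] -/

import Mathlib

open scoped BigOperators ENNReal Nat MeasureTheory Asymptotics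

noncomputable section

namespace SymmQuotient

/-- The quotient map `π : ℂⁿ → ℂⁿ // Sₙ ≅ ℂⁿ`, `x ↦ (e₁(x), …, eₙ(x))`, given by the elementary
symmetric polynomials (the coordinate with index `k : Fin n` is `e_{k+1}`). -/
def quotientMap (n : ℕ) (x : Fin n → ℂ) : Fin n → ℂ :=
  fun k => MvPolynomial.aeval x (MvPolynomial.esymm (Fin n) ℂ (k + 1))

/-- The real points of affine space `ℂⁿ` with its standard real structure. This is used both for
`X(ℝ) ⊆ X = ℂⁿ` and for `Y(ℝ) ⊆ Y = ℂⁿ`. -/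
def realPoints (n : ℕ) : Set (Fin n → ℂ) :=
  {y | ∀ k, (starRingEnd ℂ) (y k) = y k}

/-- The real image `L = π(ℝⁿ) ⊆ Y(ℝ)`. -/
def realImage (n : ℕ) : Set (Fin n → ℂ) :=
  quotientMap n '' realPoints n

/-- A Hermitian inner product on `ℂⁿ` is invariant under the permutation action of `Sₙ`. -/
def IsPermInvariant {n : ℕ} (h : InnerProductSpace.Core ℂ (Fin n → ℂ)) : Prop :=
  ∀ (σ : Equiv.Perm (Fin n)) (x y : Fin n → ℂ),
    h.inner (fun i => x (σ i)) (fun i => y (σ i)) = h.inner x y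

/-- The vector space `ℂⁿ` endowed with the Hermitian inner product `h`
(and not with the sup norm of `Fin n → ℂ`). -/
def HermitianSpace {n : ℕ} (_h : InnerProductSpace.Core ℂ (Fin n → ℂ)) : Type :=
  Fin n → ℂ

section Instances

variable {n : ℕ} (h : InnerProductSpace.Core ℂ (Fin n → ℂ))

/-- The norm is `‖x‖ = √(Re h(x, x))`. -/
instance : NormedAddCommGroup (HermitianSpace h) :=
  @InnerProductSpace.Core.toNormedAddCommGroup ℂ (Fin n → ℂ) _ _ _ h

instance : InnerProductSpace ℂ (HermitianSpace h) :=
  @InnerProductSpace.ofCore ℂ (Fin n → ℂ) _ _ _ h.toCore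

instance : MeasurableSpace (HermitianSpace h) := borel _

instance : BorelSpace (HermitianSpace h) := ⟨rfl⟩

end Instances

/-- The identity map `ℂⁿ → (ℂⁿ, h)`. -/
def toHermitian {n : ℕ} (h : InnerProductSpace.Core ℂ (Fin n → ℂ)) :
    (Fin n → ℂ) ≃ HermitianSpace h :=
  Equiv.refl _

/-- The induced geometric volume of a set `U ⊆ Y(ℝ)`:
`vol(U) = |Sₙ|⁻¹ · ℋⁿ(π⁻¹(U))`, with `ℋⁿ` the `n`-dimensional Hausdorff measure of the
metric on `ℂⁿ` given by `h`. -/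
def quotientVolume {n : ℕ} (h : InnerProductSpace.Core ℂ (Fin n → ℂ))
    (U : Set (Fin n → ℂ)) : ℝ≥0∞ :=
  (Fintype.card (Equiv.Perm (Fin n)) : ℝ≥0∞)⁻¹ *
    μH[(n : ℝ)] (toHermitian h '' (quotientMap n ⁻¹' U))

/-- The quotient distance on `Y`: the distance between the fibres (that is, orbits) of `π`
over two points, measured with `h`. -/
def quotientDist {n : ℕ} (h : InnerProductSpace.Core ℂ (Fin n → ℂ))
    (y y' : Fin n → ℂ) : ℝ :=
  sInf {d : ℝ | ∃ x x' : Fin n → ℂ, quotientMap n x = y ∧ quotientMap n x' = y' ∧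
    d = dist (toHermitian h x) (toHermitian h x')}

/-- The metric ball in `Y(ℝ)` of radius `r` centred at the origin `π(0)`. -/
def realBall {n : ℕ} (h : InnerProductSpace.Core ℂ (Fin n → ℂ)) (r : ℝ) :
    Set (Fin n → ℂ) :=
  {y | y ∈ realPoints n ∧ quotientDist h y (quotientMap n 0) < r}

/-- `Inv(G) = {σ ∈ G | σ² = id}` (the identity is included). -/
def involutionSet (G : Type*) [Group G] : Set G :=
  {σ | σ ^ 2 = 1}

/-- The number `#Inv(Sₙ)`. -/
def numInv (n : ℕ) : ℕ :=
  (involutionSet (Equiv.Perm (Fin n))).ncard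

end SymmQuotient

end

/-! A fibre of `π` is an `Sₙ`-orbit, so `π(x)` is real exactly when conjugation permutes the entries
of `x`, and the permutation can be taken to be an involution. Hence `π⁻¹(Y(ℝ))` is the union of the
real subspaces `twistedReal σ` with `σ² = 1` (`preimage_realPoints`), while `π⁻¹(π(ℝⁿ))` is the one
with `σ = 1`. Invariance of `h` makes the ball around `π(0)` pull back to the `h`-ball intersected
with this union. Each subspace has real dimension `n`, so each contributes the measure of a
Euclidean `n`-ball; distinct ones meet in null sets. The ratio is therefore `1 / #Inv(Sₙ)`.

The growth bounds come from `I(n+2) = I(n+1) + (n+1) I(n)`: it gives `I(n) ≤ n^(n/2)` by induction,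
and `n! ≤ n I(n)²`, whence the exponential bound. -/

namespace SymmQuotient

/-! ### Counting involutions -/

/-- The number of permutations of `n` points that are a product of `k` disjoint transpositions. -/
lemma card_cycleType_eq_replicate_two (n k : ℕ) (hk : 2 * k ≤ n) :
    ((Finset.univ.filter fun σ : Equiv.Perm (Fin n) =>
        σ.cycleType = Multiset.replicate k 2).card : ℝ) =
      (n ! : ℝ) / ((2 : ℝ) ^ k * (k ! : ℝ) * ((n - 2 * k)! : ℝ)) := by
  have h := Equiv.Perm.card_of_cycleType_mul_eq (Fin n) (Multiset.replicate k 2)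
  have hcond : (Multiset.replicate k 2).sum ≤ Fintype.card (Fin n) ∧
      ∀ a ∈ Multiset.replicate k 2, 2 ≤ a := by
    refine ⟨by simpa [mul_comm] using hk, fun a ha => (Multiset.eq_of_mem_replicate ha).ge⟩
  rw [if_pos hcond] at h
  have hprod : ∏ m ∈ (Multiset.replicate k 2).toFinset, ((Multiset.replicate k 2).count m)! =
      k ! := by
    rcases Nat.eq_zero_or_pos k with rfl | hk0
    · simp
    · simp [Multiset.toFinset_replicate, hk0.ne']
  rw [hprod] at h
  simp only [Multiset.sum_replicate, Multiset.prod_replicate, Fintype.card_fin, smul_eq_mul] at h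
  rw [eq_div_iff (by positivity), ← h, mul_comm 2 k]
  push_cast
  ring

lemma card_cycleType_le_of_sq_eq_one {n : ℕ} {σ : Equiv.Perm (Fin n)} (hσ : σ ^ 2 = 1) :
    2 * σ.cycleType.card ≤ n := by
  have h1 := σ.sum_cycleType_le
  rw [Equiv.Perm.cycleType_of_pow_prime_eq_one hσ] at h1
  simpa [mul_comm] using h1

theorem numInv_eq_sum (n : ℕ) : (numInv n : ℝ) =
    ∑ k ∈ Finset.range (n / 2 + 1),
      (n ! : ℝ) / ((2 : ℝ) ^ k * (k ! : ℝ) * ((n - 2 * k)! : ℝ)) := by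
  classical
  have hset : involutionSet (Equiv.Perm (Fin n)) =
      ↑(Finset.univ.filter fun σ : Equiv.Perm (Fin n) => σ ^ 2 = 1) := by
    ext σ; simp [involutionSet]
  rw [numInv, hset, Set.ncard_coe_finset,
    Finset.card_eq_sum_card_fiberwise (f := fun σ => σ.cycleType.card)
      (t := Finset.range (n / 2 + 1))]
  · push_cast
    refine Finset.sum_congr rfl fun k hk => ?_
    rw [Finset.mem_range] at hk
    rw [← card_cycleType_eq_replicate_two n k (by omega)]
    congr 2
    ext σ
    simp only [Finset.mem_filter, Finset.mem_univ, true_and]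
    rw [Multiset.eq_replicate, ← Equiv.Perm.pow_prime_eq_one_iff, and_comm]
  · intro σ hσ
    have := card_cycleType_le_of_sq_eq_one (by simpa using hσ : σ ^ 2 = 1)
    simp only [Finset.coe_range, Set.mem_Iio]
    omega

/-- Pascal-type rule for the summands of `numInv_eq_sum`. -/
lemma involution_term_succ (n k : ℕ) (hk : 2 * k + 1 ≤ n) :
    ((n + 1)! : ℝ) / ((2 : ℝ) ^ (k + 1) * ((k + 1)! : ℝ) * ((n + 1 - 2 * (k + 1))! : ℝ)) =
      (if 2 * (k + 1) ≤ n then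
        (n ! : ℝ) / ((2 : ℝ) ^ (k + 1) * ((k + 1)! : ℝ) * ((n - 2 * (k + 1))! : ℝ)) else 0) +
      n * (((n - 1)! : ℝ) / ((2 : ℝ) ^ k * (k ! : ℝ) * ((n - 1 - 2 * k)! : ℝ))) := by
  obtain ⟨m, rfl⟩ := Nat.exists_eq_add_of_le hk
  have e1 : 2 * k + 1 + m + 1 - 2 * (k + 1) = m := by omega
  have e2 : 2 * k + 1 + m - 1 = 2 * k + m := by omega
  have e3 : 2 * k + m - 2 * k = m := by omega
  have e4 : 2 * k + 1 + m = (2 * k + m) + 1 := by omega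
  rw [e1, e2, e3, e4]
  have f1 : (((2 * k + m) + 1 + 1)! : ℝ) = (2 * k + m + 2) * ((2 * k + m + 1) * (2 * k + m)!) := by
    rw [Nat.factorial_succ, Nat.factorial_succ]; push_cast; ring
  have f2 : (((2 * k + m) + 1)! : ℝ) = (2 * k + m + 1) * (2 * k + m)! := by
    rw [Nat.factorial_succ]; push_cast; ring
  have f3 : ((k + 1)! : ℝ) = (k + 1) * k ! := by
    rw [Nat.factorial_succ]; push_cast; ring
  rw [f1, f2, f3]
  -- Here `n = 2k + 1 + m`; for `m = 0` there is no room for `k + 1` disjoint transpositions among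
  -- `n` points.
  rcases m with _ | m
  · rw [if_neg (by omega)]
    simp only [Nat.factorial_zero]
    push_cast
    field_simp
    ring
  · rw [if_pos (by omega)]
    have e5 : 2 * k + (m + 1) + 1 - 2 * (k + 1) = m := by omega
    have f4 : ((m + 1)! : ℝ) = (m + 1) * m ! := by
      rw [Nat.factorial_succ]; push_cast; ring
    rw [e5, f4]
    push_cast
    field_simp
    ring

/-- Padding with zeros lets the sums for `n`, `n + 1`, `n + 2` be compared termwise; the guard is
needed because `n - 2 * k` truncates. -/
lemma numInv_eq_sum_ite (n N : ℕ) (hN : n / 2 < N) : (numInv n : ℝ) =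
    ∑ k ∈ Finset.range N, if 2 * k ≤ n then
      (n ! : ℝ) / ((2 : ℝ) ^ k * (k ! : ℝ) * ((n - 2 * k)! : ℝ)) else 0 := by
  rw [numInv_eq_sum, ← Finset.sum_filter]
  refine Finset.sum_congr ?_ fun _ _ => rfl
  ext k
  simp only [Finset.mem_range, Finset.mem_filter]
  omega

/-- Combinatorially, the last point is either fixed or swapped with one of the `n + 1` others. The
proof reads this off the closed formula, with `k` shifted by one. -/
theorem numInv_add_two (n : ℕ) :
    (numInv (n + 2) : ℝ) = numInv (n + 1) + (n + 1) * numInv n := by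
  rw [numInv_eq_sum_ite (n + 2) (n + 3) (by omega), numInv_eq_sum_ite (n + 1) (n + 3) (by omega),
    numInv_eq_sum_ite n (n + 2) (by omega), Finset.sum_range_succ', Finset.sum_range_succ' _ (n + 2),
    Finset.mul_sum, add_right_comm, ← Finset.sum_add_distrib]
  congr 1
  · refine Finset.sum_congr rfl fun k _ => ?_
    by_cases hk : 2 * k ≤ n
    · rw [if_pos (by omega), if_pos hk]
      simpa using involution_term_succ (n + 1) k (by omega)
    · rw [if_neg (by omega), if_neg (by omega), if_neg hk]; simp
  · have h1 : ((n + 2)! : ℝ) ≠ 0 := by positivity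
    have h2 : ((n + 1)! : ℝ) ≠ 0 := by positivity
    simp [h1, h2]

lemma numInv_zero : numInv 0 = 1 := by
  have h := numInv_eq_sum 0
  simp at h
  exact_mod_cast h

lemma numInv_one : numInv 1 = 1 := by
  have h := numInv_eq_sum 1
  simp at h
  exact_mod_cast h

/-! ### Growth of the number of involutions -/

/-- With `A = (x+2)^(x/2)`, the first summand is at most `√(x+2) A ≤ (x+2)/2 · A`, and Bernoulli's
`2 x^(x/2) ≤ A` bounds the second by `(x+1)/2 · A`. Both estimates use `x ≥ 2`. -/
lemma rpow_half_recurrence (n : ℕ) (hn : 2 ≤ n) :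
    ((n + 1 : ℕ) : ℝ) ^ (((n + 1 : ℕ) : ℝ) / 2) + (n + 1) * (n : ℝ) ^ ((n : ℝ) / 2) ≤
      ((n + 2 : ℕ) : ℝ) ^ (((n + 2 : ℕ) : ℝ) / 2) := by
  have hn' : (2 : ℝ) ≤ n := by exact_mod_cast hn
  push_cast
  generalize (n : ℝ) = x at hn' ⊢
  have hpos : 0 < (x + 2) ^ (x / 2) := by positivity
  have hbern : 2 * x ^ (x / 2) ≤ (x + 2) ^ (x / 2) := by
    have h1 := one_add_mul_self_le_rpow_one_add (s := 2 / x) (p := x / 2)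
      (by have : 0 ≤ 2 / x := by positivity
          linarith) (by linarith)
    have h2 : 1 + x / 2 * (2 / x) = 2 := by field_simp; norm_num
    have h3 : x + 2 = x * (1 + 2 / x) := by field_simp
    rw [h2] at h1
    rw [h3, Real.mul_rpow (by positivity) (by positivity), mul_comm]
    gcongr
  have hsplit : (x + 2) ^ ((x + 2) / 2) = (x + 2) * (x + 2) ^ (x / 2) := by
    rw [show (x + 2) / 2 = 1 + x / 2 by ring, Real.rpow_add (by positivity), Real.rpow_one]
  have hmid : (x + 1) ^ ((x + 1) / 2) ≤ (x + 2) ^ (1 / 2 : ℝ) * (x + 2) ^ (x / 2) := by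
    rw [← Real.rpow_add (by positivity), show 1 / 2 + x / 2 = (x + 1) / 2 by ring]
    gcongr
    linarith
  have hsqrt : (x + 2) ^ (1 / 2 : ℝ) ≤ (x + 2) / 2 := by
    rw [← Real.sqrt_eq_rpow]
    apply Real.sqrt_le_iff.mpr ⟨by positivity, by nlinarith⟩
  have h1 : (x + 2) ^ (1 / 2 : ℝ) * (x + 2) ^ (x / 2) ≤ (x + 2) / 2 * (x + 2) ^ (x / 2) := by
    gcongr
  rw [hsplit]
  nlinarith

theorem numInv_le_rpow (n : ℕ) : (numInv n : ℝ) ≤ (n : ℝ) ^ ((n : ℝ) / 2) := by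
  have h2 : (numInv 2 : ℝ) = 2 := by
    have := numInv_add_two 0
    rw [numInv_zero, numInv_one] at this
    norm_num at this
    exact this
  induction n using Nat.strong_induction_on with
  | _ n ih =>
    match n, ih with
    | 0, _ => simp [numInv_zero]
    | 1, _ => simp [numInv_one]
    | 2, _ => simp [h2]
    | 3, _ =>
      have h3 : (numInv 3 : ℝ) = 4 := by
        have := numInv_add_two 1
        rw [h2, numInv_one] at this
        norm_num at this
        exact this
      rw [h3]
      have h27 : ((3 : ℝ) ^ (3 / 2 : ℝ)) ^ 2 = 27 := by
        rw [← Real.rpow_natCast, ← Real.rpow_mul (by norm_num)]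
        norm_num
      have hpos : (0 : ℝ) < (3 : ℝ) ^ (3 / 2 : ℝ) := by positivity
      push_cast
      nlinarith
    | m + 4, ih =>
      rw [numInv_add_two (m + 2)]
      refine le_trans ?_ (rpow_half_recurrence (m + 2) (by omega))
      have i1 := ih (m + 2 + 1) (by omega)
      have i2 := ih (m + 2) (by omega)
      push_cast at i1 i2 ⊢
      gcongr

lemma numInv_pos (n : ℕ) : 0 < numInv n := by
  rw [numInv, Set.ncard_pos]
  exact ⟨1, by simp [involutionSet]⟩

lemma numInv_le_succ (n : ℕ) : (numInv n : ℝ) ≤ numInv (n + 1) := by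
  match n with
  | 0 => simp [numInv_zero, numInv_one]
  | m + 1 =>
    rw [numInv_add_two]
    have : (0 : ℝ) ≤ (m + 1) * numInv m := by positivity
    linarith

/-- The recurrence gives `I(n+1) I(n+2) ≥ (n+1) I(n) I(n+1)`, the step satisfied by the factorial.
-/
lemma factorial_le_numInv_mul (n : ℕ) : (n ! : ℝ) ≤ numInv n * numInv (n + 1) := by
  induction n with
  | zero => simp [numInv_zero, numInv_one]
  | succ n ih =>
    rw [numInv_add_two, Nat.factorial_succ]
    push_cast
    have h : (0 : ℝ) ≤ numInv (n + 1) * numInv (n + 1) := by positivity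
    have : ((n : ℝ) + 1) * n ! ≤ (n + 1) * (numInv n * numInv (n + 1)) := by gcongr
    nlinarith

theorem factorial_le_mul_numInv_sq (n : ℕ) (hn : 1 ≤ n) : (n ! : ℝ) ≤ n * (numInv n : ℝ) ^ 2 := by
  obtain ⟨m, rfl⟩ := Nat.exists_eq_add_of_le' hn
  have h1 := factorial_le_numInv_mul m
  have h2 := numInv_le_succ m
  rw [Nat.factorial_succ]
  push_cast
  gcongr
  refine h1.trans ?_
  rw [sq]
  gcongr

theorem one_div_numInv_isBigO :
    (fun n : ℕ => 1 / (numInv n : ℝ)) =O[Filter.atTop]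
      (fun n : ℕ => Real.exp (-(1 / 8 * (n : ℝ) * Real.log (n : ℝ)))) := by
  refine Asymptotics.IsBigO.of_bound 1 ?_
  have hlog : ∀ᶠ n : ℕ in Filter.atTop, (4 : ℝ) ≤ Real.log n :=
    (Real.tendsto_log_atTop.comp tendsto_natCast_atTop_atTop).eventually_ge_atTop 4
  filter_upwards [hlog, Filter.eventually_ge_atTop 4] with n hl hn
  have hn' : (4 : ℝ) ≤ n := by exact_mod_cast hn
  have hI : (0 : ℝ) < numInv n := by exact_mod_cast numInv_pos n
  rw [Real.norm_of_nonneg (by positivity), Real.norm_of_nonneg (by positivity), one_mul,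
    Real.exp_neg, one_div]
  gcongr
  rw [← Real.le_log_iff_exp_le hI]
  have h1 := Real.log_le_log (by positivity) (factorial_le_mul_numInv_sq n (by omega))
  rw [Real.log_mul (by positivity) (by positivity), Real.log_pow] at h1
  have h2 : (n : ℝ) * Real.log n - n ≤ Real.log (n ! : ℝ) := by
    have h3 : (n : ℝ) ^ n / n ! ≤ Real.exp n := by
      simpa using Real.pow_div_factorial_le_exp (n : ℝ) (by positivity) n
    have h4 := Real.log_le_log (by positivity) h3
    rw [Real.log_exp, Real.log_div (by positivity) (by positivity), Real.log_pow] at h4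
    linarith
  -- Now `2 log I(n) ≥ n log n - n - log n`. Since `n` and `log n` are at least 4, each subtracted
  -- term is at most `(n log n)/4`, which leaves more than the constant `1/8` requires.
  push_cast at h1
  nlinarith

/-! ### Fibres of the quotient map -/

/-- Equal multiplicities make the fibres of `x` and `y` over each value equinumerous; bijections
between them glue to a permutation. -/
lemma exists_perm_of_map_eq {ι α : Type*} [Fintype ι] {x y : ι → α}
    (h : (Finset.univ : Finset ι).val.map x = (Finset.univ : Finset ι).val.map y) :
    ∃ σ : Equiv.Perm ι, ∀ i, y (σ i) = x i := by
  classical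
  have hc : ∀ c, Nonempty ({i // x i = c} ≃ {i // y i = c}) := by
    intro c
    refine Fintype.card_eq.mp ?_
    have h1 := congrArg (Multiset.count c) h
    rw [Multiset.count_map, Multiset.count_map] at h1
    simp only [eq_comm (a := c)] at h1
    rw [Fintype.card_subtype, Fintype.card_subtype]
    exact h1
  exact ⟨Equiv.ofFiberEquiv fun c => (hc c).some, fun i => Equiv.ofFiberEquiv_map _ i⟩

lemma quotientMap_apply {n : ℕ} (x : Fin n → ℂ) (k : Fin n) :
    quotientMap n x k = ((Finset.univ : Finset (Fin n)).val.map x).esymm (k + 1) :=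
  MvPolynomial.aeval_esymm_eq_multiset_esymm (Fin n) ℂ _ x

lemma quotientMap_comp_perm {n : ℕ} (x : Fin n → ℂ) (σ : Equiv.Perm (Fin n)) :
    quotientMap n (fun i => x (σ i)) = quotientMap n x := by
  funext k
  rw [quotientMap_apply, quotientMap_apply]
  congr 1
  have := congrArg (Multiset.map x) (Multiset.map_univ_val_equiv σ)
  rwa [Multiset.map_map] at this

/-- The fibres of the quotient map are the orbits of the symmetric group. -/
theorem quotientMap_eq_iff {n : ℕ} {x y : Fin n → ℂ} :
    quotientMap n x = quotientMap n y ↔ ∃ σ : Equiv.Perm (Fin n), ∀ i, y (σ i) = x i := by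
  constructor
  · intro h
    apply exists_perm_of_map_eq
    set s := (Finset.univ : Finset (Fin n)).val.map x with hs
    set t := (Finset.univ : Finset (Fin n)).val.map y with ht
    have hsc : s.card = n := by simp [hs]
    have htc : t.card = n := by simp [ht]
    have he : ∀ j ∈ Finset.range (n + 1), s.esymm j = t.esymm j := by
      intro j hj
      rcases j with _ | j
      · simp [Multiset.esymm]
      · have := congrFun h ⟨j, by simpa using hj⟩
        rwa [quotientMap_apply, quotientMap_apply] at this
    -- Vieta: the symmetric functions determine the monic polynomial, and its roots recover the
    -- multiset.
    have hp : (s.map fun a => Polynomial.X - Polynomial.C a).prod =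
        (t.map fun a => Polynomial.X - Polynomial.C a).prod := by
      rw [Multiset.prod_X_sub_X_eq_sum_esymm, Multiset.prod_X_sub_X_eq_sum_esymm, hsc, htc]
      exact Finset.sum_congr rfl fun j hj => by rw [he j hj]
    have := congrArg Polynomial.roots hp
    rwa [Polynomial.roots_multiset_prod_X_sub_C, Polynomial.roots_multiset_prod_X_sub_C] at this
  · rintro ⟨σ, hσ⟩
    rw [← quotientMap_comp_perm y σ]
    congr 1
    funext i
    exact (hσ i).symm

lemma quotientMap_conj {n : ℕ} (x : Fin n → ℂ) (k : Fin n) :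
    quotientMap n (fun i => (starRingEnd ℂ) (x i)) k = (starRingEnd ℂ) (quotientMap n x k) := by
  simp only [quotientMap, MvPolynomial.esymm, map_sum, map_prod, MvPolynomial.aeval_X]

/-- The real structure `x ↦ conj (x ∘ σ)` twisted by `σ` has as fixed points the real subspace
`{x | ∀ i, conj (x i) = x (σ i)}`. -/
def twistedReal {n : ℕ} (σ : Equiv.Perm (Fin n)) : Set (Fin n → ℂ) :=
  {x | ∀ i, (starRingEnd ℂ) (x i) = x (σ i)}

lemma realPoints_eq_twistedReal_one (n : ℕ) : realPoints n = twistedReal 1 := rfl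

/-- If complex conjugation permutes the entries of `x`, it does so through an involution. -/
lemma exists_involution_of_conj_eq {n : ℕ} {x : Fin n → ℂ} (τ : Equiv.Perm (Fin n))
    (hτ : ∀ i, x (τ i) = (starRingEnd ℂ) (x i)) :
    ∃ σ ∈ involutionSet (Equiv.Perm (Fin n)), x ∈ twistedReal σ := by
  have hτ' : ∀ i, x (τ.symm i) = (starRingEnd ℂ) (x i) := by
    intro i
    have := hτ (τ.symm i)
    rw [Equiv.apply_symm_apply] at this
    rw [this, Complex.conj_conj]
  have him : ∀ i, (x (τ i)).im = -(x i).im := fun i => by rw [hτ]; simp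
  have him' : ∀ i, (x (τ.symm i)).im = -(x i).im := fun i => by rw [hτ']; simp
  -- `τ` need not be an involution. Since it negates imaginary parts, using `τ` above the real axis,
  -- its inverse below and the identity on it gives one.
  let f : Fin n → Fin n := fun i =>
    if 0 < (x i).im then τ i else if (x i).im < 0 then τ.symm i else i
  have hf : Function.Involutive f := by
    intro i
    rcases lt_trichotomy (x i).im 0 with h | h | h
    · have h1 : f i = τ.symm i := by simp [f, h, h.le.not_gt]
      rw [h1]
      simp [f, him', h]
    · simp [f, h]
    · have h1 : f i = τ i := by simp [f, h]
      rw [h1]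
      simp [f, him, h, h.le]
  refine ⟨hf.toPerm f, ?_, ?_⟩
  · ext i
    simp [sq, hf i]
  · intro i
    change _ = x (f i)
    rcases lt_trichotomy (x i).im 0 with h | h | h
    · have h1 : f i = τ.symm i := by simp [f, h, h.le.not_gt]
      rw [h1, hτ']
    · have h1 : f i = i := by simp [f, h]
      rw [h1]
      exact Complex.conj_eq_iff_im.mpr h
    · have h1 : f i = τ i := by simp [f, h]
      rw [h1, hτ]

theorem preimage_realPoints (n : ℕ) :
    quotientMap n ⁻¹' realPoints n =
      ⋃ σ ∈ involutionSet (Equiv.Perm (Fin n)), twistedReal σ := by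
  ext x
  simp only [Set.mem_preimage, Set.mem_iUnion, exists_prop]
  constructor
  · intro hx
    have h : quotientMap n (fun i => (starRingEnd ℂ) (x i)) = quotientMap n x := by
      funext k
      rw [quotientMap_conj]
      exact hx k
    obtain ⟨τ, hτ⟩ := quotientMap_eq_iff.mp h
    exact exists_involution_of_conj_eq τ hτ
  · rintro ⟨σ, -, hx⟩ k
    rw [← quotientMap_conj, ← quotientMap_comp_perm x σ]
    congr 2
    funext i
    exact hx i

theorem preimage_realImage (n : ℕ) :
    quotientMap n ⁻¹' realImage n = realPoints n := by
  ext x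
  constructor
  · rintro ⟨z, hz, hzx⟩
    obtain ⟨σ, hσ⟩ := quotientMap_eq_iff.mp hzx.symm
    intro i
    rw [← hσ i]
    exact hz _
  · intro hx
    exact ⟨x, hx, rfl⟩

lemma quotientMap_mem_realPoints {n : ℕ} {x : Fin n → ℂ} (hx : x ∈ realPoints n) :
    quotientMap n x ∈ realPoints n := by
  have : x ∈ quotientMap n ⁻¹' realPoints n := by
    rw [preimage_realPoints]
    exact Set.mem_biUnion (x := 1) (by simp [involutionSet]) hx
  exact this

lemma norm_toHermitian_perm {n : ℕ} {h : InnerProductSpace.Core ℂ (Fin n → ℂ)}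
    (hh : IsPermInvariant h) (σ : Equiv.Perm (Fin n)) (x : Fin n → ℂ) :
    ‖toHermitian h (fun i => x (σ i))‖ = ‖toHermitian h x‖ := by
  rw [@norm_eq_sqrt_re_inner ℂ, @norm_eq_sqrt_re_inner ℂ]
  congr 2
  exact hh σ x x

/-- The fibre over `π(0)` is `{0}` and the norm is constant on orbits, so the infimum is over a
single value. -/
lemma quotientDist_zero {n : ℕ} {h : InnerProductSpace.Core ℂ (Fin n → ℂ)}
    (hh : IsPermInvariant h) (x : Fin n → ℂ) :
    quotientDist h (quotientMap n x) (quotientMap n 0) = ‖toHermitian h x‖ := by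
  have : {d : ℝ | ∃ z z' : Fin n → ℂ, quotientMap n z = quotientMap n x ∧
      quotientMap n z' = quotientMap n 0 ∧ d = dist (toHermitian h z) (toHermitian h z')} =
      {‖toHermitian h x‖} := by
    ext d
    simp only [Set.mem_ofPred_eq, Set.mem_singleton_iff]
    have h0 : toHermitian h 0 = 0 := rfl
    constructor
    · rintro ⟨z, z', hz, hz', rfl⟩
      obtain ⟨σ, hσ⟩ := quotientMap_eq_iff.mp hz
      obtain ⟨σ', hσ'⟩ := quotientMap_eq_iff.mp hz'
      have e' : z' = 0 := funext fun i => (hσ' i).symm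
      have e : z = fun i => x (σ i) := funext fun i => (hσ i).symm
      rw [e', h0, dist_zero_right, e, norm_toHermitian_perm hh]
    · rintro rfl
      exact ⟨x, 0, rfl, rfl, by rw [h0, dist_zero_right]⟩
  rw [quotientDist, this, csInf_singleton]

lemma preimage_realBall {n : ℕ} {h : InnerProductSpace.Core ℂ (Fin n → ℂ)}
    (hh : IsPermInvariant h) (r : ℝ) :
    quotientMap n ⁻¹' realBall h r =
      quotientMap n ⁻¹' realPoints n ∩ {x | ‖toHermitian h x‖ < r} := by
  ext x
  simp [realBall, quotientDist_zero hh]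

/-! ### Hausdorff measure of the twisted real subspaces -/

noncomputable instance {n : ℕ} (h : InnerProductSpace.Core ℂ (Fin n → ℂ)) :
    InnerProductSpace ℝ (HermitianSpace h) :=
  InnerProductSpace.complexToReal

/-- `twistedReal σ` as a real subspace of `ℂⁿ` with the metric given by `h`. -/
def twistedSubmodule {n : ℕ} (h : InnerProductSpace.Core ℂ (Fin n → ℂ))
    (σ : Equiv.Perm (Fin n)) : Submodule ℝ (HermitianSpace h) where
  carrier := toHermitian h '' twistedReal σ
  add_mem' := by
    rintro _ _ ⟨x, hx, rfl⟩ ⟨y, hy, rfl⟩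
    refine ⟨x + y, fun i => ?_, rfl⟩
    simp [hx i, hy i]
  zero_mem' := ⟨0, fun i => by simp, rfl⟩
  smul_mem' := by
    rintro c _ ⟨x, hx, rfl⟩
    refine ⟨(c : ℂ) • x, fun i => ?_, rfl⟩
    simp [hx i]

lemma coe_twistedSubmodule {n : ℕ} (h : InnerProductSpace.Core ℂ (Fin n → ℂ))
    (σ : Equiv.Perm (Fin n)) :
    (twistedSubmodule h σ : Set (HermitianSpace h)) = toHermitian h '' twistedReal σ := rfl

/-- The parametrization of `twistedReal σ` by `ℝⁿ`. -/
noncomputable def twist {n : ℕ} (σ : Equiv.Perm (Fin n)) (y : Fin n → ℝ) : Fin n → ℂ :=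
  fun i => ⟨(y i + y (σ i)) / 2, (y i - y (σ i)) / 2⟩

lemma twist_mem {n : ℕ} {σ : Equiv.Perm (Fin n)}
    (hσ : σ ∈ involutionSet (Equiv.Perm (Fin n))) (y : Fin n → ℝ) :
    twist σ y ∈ twistedReal σ := by
  intro i
  have hi : σ (σ i) = i := by
    have := congrArg (fun τ : Equiv.Perm (Fin n) => τ i) hσ
    simpa [sq] using this
  apply Complex.ext <;> simp [twist, hi] <;> ring

/-- An involution-twisted real subspace is linearly isomorphic to `ℝⁿ`. -/
noncomputable def twistedEquiv {n : ℕ} (h : InnerProductSpace.Core ℂ (Fin n → ℂ)) {σ : Equiv.Perm (Fin n)}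
    (hσ : σ ∈ involutionSet (Equiv.Perm (Fin n))) :
    (Fin n → ℝ) ≃ₗ[ℝ] twistedSubmodule h σ where
  toFun y := ⟨toHermitian h (twist σ y), _, twist_mem hσ y, rfl⟩
  map_add' y z := by
    apply Subtype.ext
    change twist σ (y + z) = twist σ y + twist σ z
    funext i
    apply Complex.ext <;> simp [twist] <;> ring
  map_smul' c y := by
    apply Subtype.ext
    change twist σ (c • y) = (c : ℂ) • twist σ y
    funext i
    apply Complex.ext <;> simp [twist] <;> ring
  -- The real and imaginary parts of `twist σ y i` add up to `y i`.
  invFun x i := ((toHermitian h).symm x.1 i).re + ((toHermitian h).symm x.1 i).im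
  left_inv y := by
    funext i
    simp [twist]
    ring
  right_inv := by
    rintro ⟨_, x, hx, rfl⟩
    apply Subtype.ext
    change twist σ (fun i => (x i).re + (x i).im) = x
    funext i
    have h1 := congrArg Complex.re (hx i)
    have h2 := congrArg Complex.im (hx i)
    simp only [Complex.conj_re, Complex.conj_im] at h1 h2
    apply Complex.ext
    · simp only [twist, ← h1, ← h2]
      ring
    · simp [twist, ← h1, ← h2]

lemma finrank_twistedSubmodule {n : ℕ} (h : InnerProductSpace.Core ℂ (Fin n → ℂ))
    {σ : Equiv.Perm (Fin n)} (hσ : σ ∈ involutionSet (Equiv.Perm (Fin n))) :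
    Module.finrank ℝ (twistedSubmodule h σ) = n := by
  rw [← (twistedEquiv h hσ).finrank_eq, Module.finrank_fin_fun]

instance {n : ℕ} (h : InnerProductSpace.Core ℂ (Fin n → ℂ)) :
    FiniteDimensional ℂ (HermitianSpace h) :=
  inferInstanceAs (FiniteDimensional ℂ (Fin n → ℂ))

instance {n : ℕ} (h : InnerProductSpace.Core ℂ (Fin n → ℂ)) :
    FiniteDimensional ℝ (HermitianSpace h) :=
  FiniteDimensional.complexToReal _

section InnerProduct

variable {E : Type*} [NormedAddCommGroup E] [InnerProductSpace ℝ E]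
  [MeasurableSpace E] [BorelSpace E]

open MeasureTheory Module

/-- The Hausdorff measure of the trace of a centred ball on a subspace depends only on the
dimension of the subspace. -/
lemma hausdorffMeasure_submodule_inter_ball (V : Submodule ℝ E) [FiniteDimensional ℝ V] {d : ℕ}
    (hd : finrank ℝ V = d) (r : ℝ) :
    μH[(d : ℝ)] ((V : Set E) ∩ Metric.ball 0 r) =
      μH[(d : ℝ)] (Metric.ball (0 : EuclideanSpace ℝ (Fin d)) r) := by
  let e : V ≃ₗᵢ[ℝ] EuclideanSpace ℝ (Fin d) :=
    (stdOrthonormalBasis ℝ V).reindex (finCongr hd) |>.repr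
  have hi : Isometry fun z : EuclideanSpace ℝ (Fin d) => ((e.symm z : V) : E) :=
    V.subtypeₗᵢ.isometry.comp e.symm.isometry
  rw [← hi.hausdorffMeasure_image (Or.inl (Nat.cast_nonneg d))]
  congr 1
  ext x
  simp only [Set.mem_inter_iff, SetLike.mem_coe, Metric.mem_ball, dist_zero_right, Set.mem_image]
  constructor
  · rintro ⟨hx, hr⟩
    exact ⟨e ⟨x, hx⟩, by simpa using hr, by simp⟩
  · rintro ⟨z, hz, rfl⟩
    exact ⟨(e.symm z).2, by rwa [Submodule.norm_coe, e.symm.norm_map]⟩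

lemma hausdorffMeasure_ball_ne_zero (d : ℕ) {r : ℝ} (hr : 0 < r) :
    μH[(d : ℝ)] (Metric.ball (0 : EuclideanSpace ℝ (Fin d)) r) ≠ 0 := by
  have := isAddHaarMeasure_hausdorffMeasure (E := EuclideanSpace ℝ (Fin d))
  rw [finrank_euclideanSpace_fin] at this
  exact (Metric.measure_ball_pos _ _ hr).ne'

lemma hausdorffMeasure_ball_ne_top (d : ℕ) (r : ℝ) :
    μH[(d : ℝ)] (Metric.ball (0 : EuclideanSpace ℝ (Fin d)) r) ≠ ∞ := by
  have := isAddHaarMeasure_hausdorffMeasure (E := EuclideanSpace ℝ (Fin d))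
  rw [finrank_euclideanSpace_fin] at this
  exact measure_ball_lt_top.ne

/-- A subspace of dimension `d` meets every subspace not containing it in a set of `d`-dimensional
Hausdorff measure zero. -/
lemma hausdorffMeasure_submodule_inter_eq_zero (V W : Submodule ℝ E) [FiniteDimensional ℝ V] {d : ℕ}
    (hd : finrank ℝ V = d) (hVW : ¬ V ≤ W) :
    μH[(d : ℝ)] ((V : Set E) ∩ W) = 0 := by
  -- Inside `V` the intersection is a proper subspace, hence null for the Haar measure `ℋᵈ`.
  have hHaar := isAddHaarMeasure_hausdorffMeasure (E := V)
  rw [hd] at hHaar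
  have h0 := Measure.addHaar_submodule (μH[(d : ℝ)] : Measure V) (W.comap V.subtype)
    (by rwa [Ne, Submodule.comap_subtype_eq_top])
  rw [← V.subtypeₗᵢ.isometry.hausdorffMeasure_image (Or.inl (Nat.cast_nonneg d))] at h0
  convert h0 using 2
  ext x
  simp [and_comm]

end InnerProduct

lemma not_twistedSubmodule_le {n : ℕ} (h : InnerProductSpace.Core ℂ (Fin n → ℂ))
    {σ τ : Equiv.Perm (Fin n)} (hσ : σ ∈ involutionSet (Equiv.Perm (Fin n))) (hne : σ ≠ τ) :
    ¬ twistedSubmodule h σ ≤ twistedSubmodule h τ := by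
  intro hle
  -- A point with pairwise distinct parameters `y i = i`: lying in both subspaces forces `y (σ i) =
  -- y (τ i)`.
  have hx := twist_mem hσ fun i => ((i : ℕ) : ℝ)
  obtain ⟨z, hz, hzx⟩ := hle ⟨_, hx, rfl⟩
  obtain rfl := (toHermitian h).injective hzx
  apply hne
  ext i
  have h1 := (hx i).symm.trans (hz i)
  have h2 := congrArg (fun c : ℂ => c.re + c.im) h1
  simp only [twist] at h2
  have h3 : ((σ i : ℕ) : ℝ) = ((τ i : ℕ) : ℝ) := by linarith
  exact_mod_cast h3

open MeasureTheory

lemma hausdorffMeasure_twistedReal {n : ℕ} (h : InnerProductSpace.Core ℂ (Fin n → ℂ))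
    {σ : Equiv.Perm (Fin n)} (hσ : σ ∈ involutionSet (Equiv.Perm (Fin n))) (r : ℝ) :
    μH[(n : ℝ)] (toHermitian h '' twistedReal σ ∩ Metric.ball 0 r) =
      μH[(n : ℝ)] (Metric.ball (0 : EuclideanSpace ℝ (Fin n)) r) :=
  hausdorffMeasure_submodule_inter_ball (twistedSubmodule h σ) (finrank_twistedSubmodule h hσ) r

/-- Distinct twisted real subspaces meet in null sets, so the measure of their union is additive. -/
lemma hausdorffMeasure_iUnion_twistedReal {n : ℕ} (h : InnerProductSpace.Core ℂ (Fin n → ℂ))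
    (r : ℝ) :
    μH[(n : ℝ)] (⋃ σ ∈ involutionSet (Equiv.Perm (Fin n)),
        (toHermitian h '' twistedReal σ ∩ Metric.ball 0 r)) =
      numInv n * μH[(n : ℝ)] (Metric.ball (0 : EuclideanSpace ℝ (Fin n)) r) := by
  classical
  set s := (involutionSet (Equiv.Perm (Fin n))).toFinset with hs
  have hsc : s.card = numInv n := by rw [numInv, Set.ncard_eq_toFinset_card']
  have hU : (⋃ σ ∈ involutionSet (Equiv.Perm (Fin n)),
      (toHermitian h '' twistedReal σ ∩ Metric.ball 0 r)) =
      ⋃ σ ∈ s, (toHermitian h '' twistedReal σ ∩ Metric.ball 0 r) := by simp [hs]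
  rw [hU, measure_biUnion_finset₀]
  · rw [Finset.sum_congr rfl fun σ hσ =>
      hausdorffMeasure_twistedReal h (Set.mem_toFinset.mp hσ) r, Finset.sum_const, hsc,
      nsmul_eq_mul]
  · intro σ hσ τ _ hne
    refine measure_mono_null ?_ (hausdorffMeasure_submodule_inter_eq_zero
      (twistedSubmodule h σ) (twistedSubmodule h τ)
      (finrank_twistedSubmodule h (Set.mem_toFinset.mp hσ))
      (not_twistedSubmodule_le h (Set.mem_toFinset.mp hσ) hne))
    exact fun x hx => ⟨hx.1.1, hx.2.1⟩
  · intro σ _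
    exact ((twistedSubmodule h σ).closed_of_finiteDimensional.measurableSet.inter
      measurableSet_ball).nullMeasurableSet

/-! ### Volumes of the ball and of its real image -/

lemma toHermitian_image_ball {n : ℕ} (h : InnerProductSpace.Core ℂ (Fin n → ℂ)) (r : ℝ) :
    toHermitian h '' {x | ‖toHermitian h x‖ < r} = Metric.ball 0 r := by
  rw [Equiv.image_eq_preimage_symm]
  ext x
  simp

theorem quotientVolume_realBall {n : ℕ} {h : InnerProductSpace.Core ℂ (Fin n → ℂ)}
    (hh : IsPermInvariant h) (r : ℝ) :
    quotientVolume h (realBall h r) = (Fintype.card (Equiv.Perm (Fin n)) : ℝ≥0∞)⁻¹ *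
      (numInv n * μH[(n : ℝ)] (Metric.ball (0 : EuclideanSpace ℝ (Fin n)) r)) := by
  rw [quotientVolume, preimage_realBall hh, preimage_realPoints,
    Set.image_inter (toHermitian h).injective, toHermitian_image_ball, Set.image_iUnion₂,
    Set.iUnion₂_inter, hausdorffMeasure_iUnion_twistedReal]

theorem quotientVolume_realImage_inter_realBall {n : ℕ}
    {h : InnerProductSpace.Core ℂ (Fin n → ℂ)} (hh : IsPermInvariant h) (r : ℝ) :
    quotientVolume h (realImage n ∩ realBall h r) =
      (Fintype.card (Equiv.Perm (Fin n)) : ℝ≥0∞)⁻¹ *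
        μH[(n : ℝ)] (Metric.ball (0 : EuclideanSpace ℝ (Fin n)) r) := by
  have hsub : realPoints n ⊆ quotientMap n ⁻¹' realPoints n :=
    fun x hx => quotientMap_mem_realPoints hx
  rw [quotientVolume, Set.preimage_inter, preimage_realImage, preimage_realBall hh,
    ← Set.inter_assoc, Set.inter_eq_left.mpr hsub, Set.image_inter (toHermitian h).injective,
    toHermitian_image_ball, realPoints_eq_twistedReal_one,
    hausdorffMeasure_twistedReal h (by simp [involutionSet])]

theorem quotientVolume_ratio {n : ℕ} {h : InnerProductSpace.Core ℂ (Fin n → ℂ)}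
    (hh : IsPermInvariant h) {r : ℝ} (hr : 0 < r) :
    quotientVolume h (realImage n ∩ realBall h r) / quotientVolume h (realBall h r) =
      1 / (numInv n : ℝ≥0∞) := by
  -- Cancelling a factor in `ℝ≥0∞` requires it to be nonzero and finite.
  have h0 := hausdorffMeasure_ball_ne_zero n hr
  have h1 := hausdorffMeasure_ball_ne_top n r
  have hc : (Fintype.card (Equiv.Perm (Fin n)) : ℝ≥0∞)⁻¹ ≠ 0 :=
    ENNReal.inv_ne_zero.mpr (ENNReal.natCast_ne_top _)
  have hc' : (Fintype.card (Equiv.Perm (Fin n)) : ℝ≥0∞)⁻¹ ≠ ∞ :=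
    ENNReal.inv_ne_top.mpr (by exact_mod_cast Fintype.card_ne_zero)
  rw [quotientVolume_realBall hh, quotientVolume_realImage_inter_realBall hh,
    ENNReal.mul_div_mul_left _ _ hc hc', ← ENNReal.mul_div_mul_right 1 (numInv n : ℝ≥0∞) h0 h1, one_mul]

end SymmQuotient

theorem corollary4p3 :
    (∀ (n : ℕ) (h : InnerProductSpace.Core ℂ (Fin n → ℂ)),
      SymmQuotient.IsPermInvariant h →
      ∀ r : ℝ, 0 < r →
        SymmQuotient.quotientVolume h
            (SymmQuotient.realImage n ∩ SymmQuotient.realBall h r) /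
          SymmQuotient.quotientVolume h (SymmQuotient.realBall h r) =
        1 / (SymmQuotient.numInv n : ℝ≥0∞)) ∧
    (∀ n : ℕ, (SymmQuotient.numInv n : ℝ) =
      ∑ k ∈ Finset.range (n / 2 + 1),
        ((n)! : ℝ) / ((2 : ℝ) ^ k * ((k)! : ℝ) * ((n - 2 * k)! : ℝ))) ∧
    (fun n : ℕ => (SymmQuotient.numInv n : ℝ)) =O[Filter.atTop]
      (fun n : ℕ => (n : ℝ) ^ ((n : ℝ) / 2)) ∧
    ∃ C : ℝ, 0 < C ∧
      (fun n : ℕ => 1 / (SymmQuotient.numInv n : ℝ)) =O[Filter.atTop]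
        (fun n : ℕ => Real.exp (-(C * (n : ℝ) * Real.log (n : ℝ)))) := by
  refine ⟨fun n h hh r hr => SymmQuotient.quotientVolume_ratio hh hr, SymmQuotient.numInv_eq_sum,
    Asymptotics.IsBigO.of_bound 1 (Filter.Eventually.of_forall fun n => ?_), 1 / 8, by norm_num,
    SymmQuotient.one_div_numInv_isBigO⟩
  rw [Real.norm_of_nonneg (by positivity), Real.norm_of_nonneg (by positivity), one_mul]
  exact SymmQuotient.numInv_le_rpow n
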